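/- **Conventions.** Fix $n\in\{1,2,3,\dots\}\cup\{\infty\}$. A $\mathcal C^n$ *space* $X$ is a set $|X|$ together with, for every open $H\subseteq\mathbb R^u$ ($u\in\mathbb N$), a set of maps $H\to|X|$ (the *figures* of type $H$), such that: a figure composed with an ordinary $C^n$ map $J\to H$ is a figure; constant maps are figures; and a map $H\to |X|$ whose restrictions to the members of an open cover of $H$ are figures is a figure. An arrow of $\mathcal C^n$ spaces is a map taking figures to figures by composition. $X$ carries the finest topology making all figures continuous. A subset $S\subseteq|X|$ is given the space $(S\prec X)$ whose figures are the figures of $X$ with values in $S$; an open $K\subseteq\mathbb R^k$ is a $\mathcal C^n$ space with the ordinary $C^n$ maps as figures. An *observable* on the zone $UK$ ($U$ open in $X$, $K$ open in $\mathbb R^k$) is an arrow $\varphi:(U\prec X)\to K$. A map $x:\mathbb R\to|X|$ that is continuous at $0$ is *nilpotent* if for every observable $\varphi$ on every zone $UK$ with $x_0\in U$ there is $m\in\mathbb N$ with $\|\varphi(x_t)-\varphi(x_0)\|^m=o(t)$ as $t\to0$. For nilpotent $x,y$ put $x\sim y$ if for every zone $UK$ and observable $\varphi$ on it: $x_0\in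 U\Leftrightarrow y_0\in U$, and $x_0\in U$ implies $\varphi(x_t)=\varphi(y_t)+o(t)$. Let ${}^\bullet X$ be the set of nilpotent maps modulo $\sim$, and ${}^\bullet f([x])=[f\circ x]$ for an arrow $f$. For $U$ open in $X$, ${}^\bullet U:={}^\bullet(U\prec X)$ is regarded as a subset of ${}^\bullet X$. On ${}^\bullet\mathbb R^k:={}^\bullet(\mathbb R^k)$ operations are pointwise on representatives, pairs $\langle [p],[x]\rangle=[(p_t,x_t)]$ are formed pointwise, and $D:=\{[h]\in{}^\bullet\mathbb R: h_t=O(t)\}$. *Extended spaces.* Let $\mathbf S$ be the category of subsets $S\subseteq{}^\bullet\mathbb R^s$ ($s\in\mathbb N$), with the topology generated by the sets ${}^\bullet U\cap S$ ($U\subseteq \mathbb R^s$ open), whose arrows $S\to T\subseteq{}^\bullet\mathbb R^t$ are the maps $f$ such that every $\sigma\in S$ has a neighbourhood ${}^\bullet V\cap S$ on which $f(x)={}^\bullet g\langle p,x\rangle$ for some $p\in{}^\bullet U$ with $U$ open in some $\mathbb R^{q}$ and some $g\in C^n(U\times V,\mathbb R^t)$. For $Z\subseteq{}^\bullet X$,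 a *generating figure* $T\to Z$ is a map that is constant or of the form ${}^\bullet h|_T$ with $h:V\to X$ a figure, $V$ open, $T\subseteq{}^\bullet V$; a *figure* $\delta:S\to Z$ is a map which near each point of $S$ is an arrow of $\mathbf S$ followed by a generating figure. This makes $Z$ an extended space; in this way $D\subseteq{}^\bullet\mathbb R$ and ${}^\bullet X$ are extended spaces. Arrows of ${}^\bullet\mathcal C^n$ are the maps that take figures to figures by composition. *Derivation formula.* For an arrow $f:D\to{}^\bullet X$ of ${}^\bullet\mathcal C^n$ and an observable $\varphi$ on a zone $U\mathbb R^k$ with $f(0)\in{}^\bullet U$, one has $f(h)\in{}^\bullet U$ for all $h\in D$, and $\varphi'(f)$ denotes the unique $b\in\mathbb R^k$ for which there is $a\in{}^\bullet\mathbb R^k$ with ${}^\bullet\varphi(f(h))=a+h\cdot b$ for all $h\in D$. **Theorem.** Let $X$ be a $\mathcal C^n$ space and let $f,g:D\to{}^\bullet X$ be arrows of ${}^\bullet\mathcal C^n$ with $f(0)=g(0)$. Assume that $\varphi'(f)=\varphi'(g)$ for every $k\in\mathbb N$ and every observable $\varphi$ on a zone $U\mathbb R^k$ of $X$ with $f(0)\in{}^\bullet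 U$. Then $f=g$. -/

import Mathlib

open Set Filter Topology TopologicalSpace Asymptotics

noncomputable section

/-- The Euclidean space `ℝ^k`. -/
abbrev Euc (k : ℕ) : Type := EuclideanSpace ℝ (Fin k)

/-- `f : U → ℝ^v` is an ordinary map of class `C^n` on the open set `U ⊆ ℝ^u`. -/
def IsCn (n : ℕ∞) {u v : ℕ} (U : Opens (Euc u)) (f : U → Euc v) : Prop :=
  ∃ F : Euc u → Euc v, ContDiffOn ℝ n F U ∧ ∀ x : U, F x = f x

theorem IsCn.continuous {n : ℕ∞} {u v : ℕ} {U : Opens (Euc u)} {f : U → Euc v}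
    (hf : IsCn n U f) : Continuous f := by
  obtain ⟨F, hF, hFf⟩ := hf
  have : f = (U : Set (Euc u)).domRestrict F := by
    funext x; exact (hFf x).symm
  rw [this]
  exact hF.continuousOn.domRestrict

/-- A `C^n` space: a set with, for every open set `H` of every `ℝ^u`, a set of figures `H → X`,
closed under reparametrization by `C^n` maps, containing the constants, and local. -/
structure CnSpace (n : ℕ∞) where
  carrier : Type*
  IsFig : ∀ {u : ℕ} (H : Opens (Euc u)), (H → carrier) → Prop
  comp : ∀ {u v : ℕ} {J : Opens (Euc u)} {H : Opens (Euc v)} (f : J → H) (d : H → carrier),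
    IsCn n J (fun x => (f x : Euc v)) → IsFig H d → IsFig J (d ∘ f)
  const : ∀ {u : ℕ} (H : Opens (Euc u)) (c : carrier), IsFig H (fun _ => c)
  sheaf : ∀ {u : ℕ} (H : Opens (Euc u)) (d : H → carrier),
    (∀ x : H, ∃ (V : Opens (Euc u)) (hV : V ≤ H), (x : Euc u) ∈ V ∧
      IsFig V (fun y => d ⟨y, hV y.2⟩)) → IsFig H d

namespace CnSpace

variable {n : ℕ∞}

instance : CoeSort (CnSpace n) (Type _) := ⟨CnSpace.carrier⟩

/-- Arrows of `C^n` spaces: maps sending figures to figures of the same type. -/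
structure Hom (X Y : CnSpace n) where
  toFun : X → Y
  map_fig : ∀ {u : ℕ} (H : Opens (Euc u)) (d : H → X), X.IsFig H d → Y.IsFig H (toFun ∘ d)

instance (X Y : CnSpace n) : CoeFun (Hom X Y) (fun _ => X → Y) := ⟨Hom.toFun⟩

/-- Composition of arrows. -/
def Hom.comp {X Y Z : CnSpace n} (g : Hom Y Z) (f : Hom X Y) : Hom X Z where
  toFun := g ∘ f
  map_fig H d hd := g.map_fig H _ (f.map_fig H d hd)

/-- The final topology of a `C^n` space: the finest one making all figures continuous. -/
@[reducible] def top (X : CnSpace n) : TopologicalSpace X where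
  IsOpen W := ∀ {u : ℕ} (H : Opens (Euc u)) (d : H → X), X.IsFig H d → IsOpen (d ⁻¹' W)
  isOpen_univ _ _ _ := isOpen_univ
  isOpen_inter _ _ hs ht u H d hd := (hs H d hd).inter (ht H d hd)
  isOpen_sUnion _ hS u H d hd := by
    rw [preimage_sUnion]
    exact isOpen_biUnion fun t ht => hS t ht H d hd

theorem isOpen_top_iff {X : CnSpace n} {W : Set X} : IsOpen[X.top] W ↔
    ∀ {u : ℕ} (H : Opens (Euc u)) (d : H → X), X.IsFig H d → IsOpen (d ⁻¹' W) :=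
  Iff.rfl

/-- The subspace `(S ≺ X)` induced on a subset `S` of `X`. -/
def sub (X : CnSpace n) (S : Set X) : CnSpace n where
  carrier := S
  IsFig H d := X.IsFig H (fun x => (d x : X))
  comp f d hf hd := X.comp f (fun x => (d x : X)) hf hd
  const H c := X.const H (c : X)
  sheaf H d h := X.sheaf H (fun x => (d x : X)) h

/-- The inclusion `(S ≺ X) → X`. -/
def incl (X : CnSpace n) (S : Set X) : Hom (X.sub S) X where
  toFun := Subtype.val
  map_fig _ _ hd := hd

/-- The restriction `(f⁻¹(V) ≺ X) → (V ≺ Y)` of an arrow `f : X → Y`. -/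
def Hom.restrictPreimage {X Y : CnSpace n} (f : Hom X Y) (V : Set Y) :
    Hom (X.sub (f ⁻¹' V)) (Y.sub V) where
  toFun a := ⟨f a.1, a.2⟩
  map_fig H d hd := f.map_fig H (fun x => (d x).1) hd

theorem Hom.isOpen_preimage {X Y : CnSpace n} (f : Hom X Y) {V : Set Y}
    (hV : IsOpen[Y.top] V) : IsOpen[X.top] (f ⁻¹' V) := by
  refine isOpen_top_iff.2 fun {u} H d hd => ?_
  exact isOpen_top_iff.1 hV H (f ∘ d) (f.map_fig H d hd)

/-- `ℝ^k` as a `C^n` space; its figures are the ordinary `C^n` maps. -/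
@[reducible] def real (n : ℕ∞) (k : ℕ) : CnSpace n where
  carrier := Euc k
  IsFig H d := IsCn n H d
  comp {u v J H} f d hf hd := by
    obtain ⟨F, hF, hFf⟩ := hf
    obtain ⟨G, hG, hGd⟩ := hd
    refine ⟨G ∘ F, hG.comp hF ?_, ?_⟩
    · intro x hx
      have := hFf ⟨x, hx⟩
      simp only at this
      rw [this]
      exact (f ⟨x, hx⟩).2
    · intro x
      simp [hFf x, hGd]
  const H c := ⟨fun _ => c, contDiffOn_const, fun _ => rfl⟩
  sheaf {u} H d h := by
    classical
    refine ⟨fun x => if hx : x ∈ H then d ⟨x, hx⟩ else 0, ?_, fun x => by simp⟩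
    intro x hx
    obtain ⟨V, hV, hxV, F, hF, hFd⟩ := h ⟨x, hx⟩
    have h1 : ContDiffAt ℝ n F x := hF.contDiffAt (V.isOpen.mem_nhds hxV)
    refine (h1.congr_of_eventuallyEq ?_).contDiffWithinAt
    filter_upwards [V.isOpen.mem_nhds hxV] with y hy
    have hyH : y ∈ H := hV hy
    simp only [hyH, dif_pos]
    exact (hFd ⟨y, hy⟩).symm

/-- The `C^n` space of an open set `K ⊆ ℝ^k`; its figures are the ordinary `C^n` maps into `K`. -/
def ofOpen (n : ℕ∞) {k : ℕ} (K : Opens (Euc k)) : CnSpace n :=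
  (real n k).sub (K : Set (Euc k))

/-- An observable of `X` on the zone given by the open `U ⊆ X` and the open `K ⊆ ℝ^k`:
an arrow `(U ≺ X) → K`. -/
abbrev Observable (X : CnSpace n) (U : Set X) {k : ℕ} (K : Opens (Euc k)) : Type _ :=
  Hom (X.sub U) (ofOpen n K)

open Classical in
/-- The value `φ(x) ∈ ℝ^k` of an observable at a point of `U` (and `0` outside `U`). -/
def Observable.val {X : CnSpace n} {U : Set X} {k : ℕ} {K : Opens (Euc k)}
    (φ : X.Observable U K) (a : X) : Euc k :=
  if h : a ∈ U then (φ.toFun ⟨a, h⟩).1 else 0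

/-- `x : ℝ → X` is continuous at the origin for the topology of `X`. -/
def IsC0 (X : CnSpace n) (x : ℝ → X) : Prop :=
  Tendsto x (𝓝 0) (@nhds X X.top (x 0))

/-- `x : ℝ → X` is a nilpotent path of `X`. -/
def IsNil (X : CnSpace n) (x : ℝ → X) : Prop :=
  X.IsC0 x ∧ ∀ (U : Set X), IsOpen[X.top] U → ∀ (k : ℕ) (K : Opens (Euc k))
    (φ : X.Observable U K), x 0 ∈ U →
      ∃ m : ℕ, (fun t => ‖φ.val (x t) - φ.val (x 0)‖ ^ m) =o[𝓝 0] (fun t : ℝ => t)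

/-- The set of nilpotent paths of `X`. -/
def NilPath (X : CnSpace n) : Type _ := {x : ℝ → X // X.IsNil x}

/-- `x ∼ y`: for every zone and every observable `φ` on it, `x₀ ∈ U ↔ y₀ ∈ U`, and
`φ(x_t) = φ(y_t) + o(t)` if `x₀ ∈ U`. -/
def Sim (X : CnSpace n) (x y : X.NilPath) : Prop :=
  ∀ (U : Set X), IsOpen[X.top] U → ∀ (k : ℕ) (K : Opens (Euc k)) (φ : X.Observable U K),
    (x.1 0 ∈ U ↔ y.1 0 ∈ U) ∧
    (x.1 0 ∈ U → (fun t => φ.val (x.1 t) - φ.val (y.1 t)) =o[𝓝 0] (fun t : ℝ => t))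

theorem Sim.equivalence (X : CnSpace n) : Equivalence X.Sim where
  refl x U _ k K φ := ⟨Iff.rfl, fun _ => by simp⟩
  symm {x y} h U hU k K φ := by
    obtain ⟨h1, h2⟩ := h U hU k K φ
    exact ⟨h1.symm, fun hy => (h2 (h1.2 hy)).symm⟩
  trans {x y z} h h' U hU k K φ := by
    obtain ⟨h1, h2⟩ := h U hU k K φ
    obtain ⟨h3, h4⟩ := h' U hU k K φ
    exact ⟨h1.trans h3, fun hx => (h2 hx).triangle (h4 (h1.1 hx))⟩

instance simSetoid (X : CnSpace n) : Setoid X.NilPath := ⟨X.Sim, Sim.equivalence X⟩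

/-- The extension `•X`: nilpotent paths modulo `∼`. -/
def Ext (X : CnSpace n) : Type _ := Quotient X.simSetoid

/-- The class of a nilpotent path. -/
def Ext.mk {X : CnSpace n} (x : ℝ → X) (hx : X.IsNil x) : X.Ext :=
  Quotient.mk X.simSetoid ⟨x, hx⟩

theorem Observable.val_restrictPreimage {X Y : CnSpace n} (f : Hom X Y) {V : Set Y} {k : ℕ}
    {K : Opens (Euc k)} (φ : Y.Observable V K) (a : X) :
    Observable.val (X := X) (U := f ⁻¹' V) (φ.comp (f.restrictPreimage V)) a = φ.val (f a) :=
  rfl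

theorem IsNil.map {X Y : CnSpace n} (f : Hom X Y) {x : ℝ → X} (hx : X.IsNil x) :
    Y.IsNil (fun t => f (x t)) := by
  refine ⟨?_, fun V hV k K φ h0 => ?_⟩
  · have hf : @Continuous X Y X.top Y.top f := by
      let _ := X.top
      let _ := Y.top
      exact ⟨fun V hV => f.isOpen_preimage hV⟩
    exact Tendsto.comp (@Continuous.tendsto X Y X.top Y.top f hf (x 0)) hx.1
  · exact hx.2 (f ⁻¹' V) (f.isOpen_preimage hV) k K (φ.comp (f.restrictPreimage V)) h0

/-- The extension `•f : •X → •Y`, `[x] ↦ [f ∘ x]`, of an arrow `f : X → Y`. -/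
def Ext.map {X Y : CnSpace n} (f : Hom X Y) : X.Ext → Y.Ext :=
  Quotient.map (fun x => ⟨fun t => f (x.1 t), x.2.map f⟩) fun _ _ h V hV k K φ =>
    h (f ⁻¹' V) (f.isOpen_preimage hV) k K (φ.comp (f.restrictPreimage V))

/-- `•S = •(S ≺ X)` viewed as a subset of `•X` (used for open `S`). -/
def extSet (X : CnSpace n) (S : Set X) : Set X.Ext := range (Ext.map (X.incl S))

/-! ### Elementary description of `•ℝ^k` -/

/-- `‖x_t - x_0‖^m = o(t)` for some `m`. -/
def ElemNil {k : ℕ} (x : ℝ → Euc k) : Prop :=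
  ∃ m : ℕ, (fun t => ‖x t - x 0‖ ^ m) =o[𝓝 0] (fun t : ℝ => t)

theorem ElemNil.tendsto {k : ℕ} {x : ℝ → Euc k} (hx : ElemNil x) :
    Tendsto x (𝓝 0) (𝓝 (x 0)) := by
  obtain ⟨m, hm⟩ := hx
  have hm0 : m ≠ 0 := by
    rintro rfl
    have := (hm.def one_pos).self_of_nhds
    simp at this
    linarith
  have h0 : Tendsto (fun t => ‖x t - x 0‖ ^ m) (𝓝 0) (𝓝 0) :=
    hm.trans_tendsto tendsto_id
  rw [tendsto_iff_norm_sub_tendsto_zero]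
  rw [Metric.tendsto_nhds] at h0 ⊢
  intro ε hε
  filter_upwards [h0 (ε ^ m) (by positivity)] with t ht
  simp only [dist_zero_right, norm_pow, norm_norm] at ht ⊢
  exact lt_of_pow_lt_pow_left₀ m hε.le ht

theorem ElemNil.of_le {i j k : ℕ} {x : ℝ → Euc i} {y : ℝ → Euc j} {z : ℝ → Euc k} {C : ℝ}
    (hx : ElemNil x) (hy : ElemNil y)
    (h : ∀ᶠ t in 𝓝 (0 : ℝ), ‖z t - z 0‖ ≤ C * (‖x t - x 0‖ + ‖y t - y 0‖)) : ElemNil z := by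
  have bdd : ∀ {l : ℕ} {w : ℝ → Euc l}, ElemNil w → ∀ m : ℕ,
      (fun t => ‖w t - w 0‖ ^ m) =O[𝓝 0] (fun _ : ℝ => (1 : ℝ)) := by
    intro l w hw m
    have h1 : Tendsto (fun t => ‖w t - w 0‖ ^ m) (𝓝 0) (𝓝 (‖w 0 - w 0‖ ^ m)) :=
      ((hw.tendsto.sub_const _).norm).pow m
    exact h1.isBigO_one ℝ
  have bx := bdd hx
  have bdy := bdd hy
  obtain ⟨a, ha⟩ := hx
  obtain ⟨b, hb⟩ := hy
  refine ⟨a + b, ?_⟩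
  have h1 : (fun t => ‖x t - x 0‖ ^ (a + b)) =o[𝓝 0] (fun t : ℝ => t) := by
    simpa [pow_add] using ha.mul_isBigO (bx b)
  have h2 : (fun t => ‖y t - y 0‖ ^ (a + b)) =o[𝓝 0] (fun t : ℝ => t) := by
    simpa [pow_add] using (bdy a).mul_isLittleO hb
  refine IsBigO.trans_isLittleO (IsBigO.of_bound (|C| ^ (a + b) * 2 ^ (a + b)) ?_) (h1.add h2)
  filter_upwards [h] with t ht
  set u := ‖x t - x 0‖
  set v := ‖y t - y 0‖
  have hu : 0 ≤ u := norm_nonneg _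
  have hv : 0 ≤ v := norm_nonneg _
  have h3 : ‖z t - z 0‖ ≤ |C| * (2 * max u v) := by
    refine ht.trans ((mul_le_mul_of_nonneg_right (le_abs_self C) (by positivity)).trans ?_)
    gcongr
    linarith [le_max_left u v, le_max_right u v]
  have h4 : max u v ^ (a + b) ≤ u ^ (a + b) + v ^ (a + b) := by
    rcases le_total u v with h | h
    · rw [max_eq_right h]; linarith [pow_nonneg hu (a + b)]
    · rw [max_eq_left h]; linarith [pow_nonneg hv (a + b)]
  rw [Real.norm_of_nonneg (by positivity), Real.norm_of_nonneg (by positivity)]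
  calc ‖z t - z 0‖ ^ (a + b) ≤ (|C| * (2 * max u v)) ^ (a + b) := by gcongr
    _ = |C| ^ (a + b) * 2 ^ (a + b) * max u v ^ (a + b) := by rw [mul_pow, mul_pow, mul_assoc]
    _ ≤ _ := by gcongr

theorem isOpen_real_iff {k : ℕ} {W : Set (Euc k)} :
    IsOpen[(real n k).top] W ↔ IsOpen W := by
  constructor
  · intro h
    have h1 := isOpen_top_iff.1 h (⊤ : Opens (Euc k)) (fun x => x.1) ⟨id, contDiffOn_id, fun _ => rfl⟩
    have h2 := (⊤ : Opens (Euc k)).isOpen.isOpenMap_subtype_val _ h1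
    convert h2 using 1
    ext a
    simp
  · intro h
    refine isOpen_top_iff.2 fun {u} H d hd => ?_
    exact h.preimage (IsCn.continuous hd)

theorem nhds_real {k : ℕ} (a : real n k) :
    @nhds (real n k) (real n k).top a = @nhds (Euc k) _ a := by
  have : (real n k).top = (inferInstance : TopologicalSpace (Euc k)) := by
    ext W
    exact isOpen_real_iff
  rw [this]

/-- Observables of `ℝ^k` are the ordinary `C^n` maps. -/
theorem Observable.contDiffOn_val {k j : ℕ} {U : Set (Euc k)}
    (hU : IsOpen[(real n k).top] U) {K : Opens (Euc j)} (φ : (real n k).Observable U K) :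
    ContDiffOn ℝ n (φ.val : Euc k → Euc j) (U : Set (Euc k)) := by
  obtain ⟨F, hF, hFf⟩ := φ.map_fig (⟨U, isOpen_real_iff.1 hU⟩ : Opens (Euc k)) (fun x => x)
    ⟨id, contDiffOn_id, fun _ => rfl⟩
  refine hF.congr fun a ha => ?_
  have h1 := hFf ⟨a, ha⟩
  rw [h1]
  exact dif_pos ha

theorem Observable.lipschitz_val [hn : Fact (1 ≤ n)] {k j : ℕ} {U : Set (Euc k)}
    (hU : IsOpen[(real n k).top] U) {K : Opens (Euc j)} (φ : (real n k).Observable U K)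
    {a : Euc k} (ha : a ∈ U) :
    ∃ C : ℝ, ∃ s ∈ 𝓝 a, ∀ x ∈ s, ∀ y ∈ s, ‖φ.val x - φ.val y‖ ≤ C * ‖x - y‖ := by
  have h1 : ContDiffAt ℝ 1 (φ.val : Euc k → Euc j) a :=
    ((φ.contDiffOn_val hU).contDiffAt ((isOpen_real_iff.1 hU).mem_nhds ha)).of_le
      (by exact_mod_cast hn.out)
  obtain ⟨C, s, hs, hC⟩ := h1.exists_lipschitzOnWith
  refine ⟨C, s, hs, fun x hx y hy => ?_⟩
  simpa [dist_eq_norm] using hC.dist_le_mul x hx y hy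

/-- The tautological observable on all of `ℝ^k`. -/
def idObs (n : ℕ∞) (k : ℕ) : (real n k).Observable univ (⊤ : Opens (Euc k)) where
  toFun a := ⟨a.1, trivial⟩
  map_fig _ _ hd := hd

theorem idObs_val {k : ℕ} (a : real n k) : (idObs n k).val a = a :=
  dif_pos (mem_univ a)

theorem isNil_real_iff [Fact (1 ≤ n)] {k : ℕ} {x : ℝ → Euc k} :
    (real n k).IsNil x ↔ ElemNil x := by
  constructor
  · intro h
    obtain ⟨m, hm⟩ := h.2 univ (isOpen_real_iff.2 isOpen_univ) k ⊤ (idObs n k) trivial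
    refine ⟨m, ?_⟩
    simpa only [idObs_val] using hm
  · intro h
    refine ⟨?_, fun U hU j K φ h0 => ?_⟩
    · unfold IsC0
      rw [nhds_real]
      exact h.tendsto
    · obtain ⟨C, s, hs, hC⟩ := φ.lipschitz_val hU h0
      have h2 : ElemNil (fun t => φ.val (x t)) := by
        refine ElemNil.of_le (C := |C|) h h ?_
        filter_upwards [h.tendsto hs] with t ht
        refine (hC _ ht _ (mem_of_mem_nhds hs)).trans ?_
        gcongr
        · exact le_abs_self C
        · linarith [norm_nonneg (x t - x 0)]
      exact h2

/-- `x = y` in `•ℝ^k` iff `x_t = y_t + o(t)`. -/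
theorem Ext.mk_real_eq_iff [Fact (1 ≤ n)] {k : ℕ} {x y : ℝ → Euc k}
    {hx : (real n k).IsNil x} {hy : (real n k).IsNil y} :
    (Ext.mk x hx : (real n k).Ext) = Ext.mk y hy ↔
      (fun t => x t - y t) =o[𝓝 0] (fun t : ℝ => t) := by
  refine (Quotient.eq (r := (real n k).simSetoid)).trans ⟨?_, ?_⟩
  · intro h
    have := (h univ (isOpen_real_iff.2 isOpen_univ) k ⊤ (idObs n k)).2 trivial
    simpa only [idObs_val] using this
  · intro h U hU j K φ
    have h0 : x 0 = y 0 := by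
      have := (h.def one_pos).self_of_nhds
      simpa [sub_eq_zero] using this
    refine ⟨by change x 0 ∈ U ↔ y 0 ∈ U; rw [h0], fun hU0 => ?_⟩
    obtain ⟨C, s, hs, hC⟩ := φ.lipschitz_val hU hU0
    refine IsBigO.trans_isLittleO (IsBigO.of_bound C ?_) h
    have hs' : s ∈ 𝓝 (y 0) := h0 ▸ hs
    filter_upwards [(isNil_real_iff.1 hx).tendsto hs, (isNil_real_iff.1 hy).tendsto hs']
      with t h1 h2
    exact hC _ h1 _ h2

/-- Pointwise operations on representatives, for an operation which is Lipschitz. -/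
theorem ElemNil.map₂ {i j k : ℕ} (op : Euc i × Euc j →L[ℝ] Euc k) {x : ℝ → Euc i}
    {y : ℝ → Euc j} (hx : ElemNil x) (hy : ElemNil y) : ElemNil (fun t => op (x t, y t)) := by
  refine ElemNil.of_le (C := ‖op‖) hx hy (Eventually.of_forall fun t => ?_)
  rw [← map_sub]
  refine (op.le_opNorm _).trans ?_
  gcongr
  simp only [Prod.mk_sub_mk, Prod.norm_mk]
  exact max_le_add_of_nonneg (norm_nonneg _) (norm_nonneg _)

/-- The pointwise action `([x],[y]) ↦ [t ↦ op(x_t, y_t)]` of a linear map on extended points. -/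
def Ext.linMap₂ [Fact (1 ≤ n)] {i j k : ℕ} (op : Euc i × Euc j →L[ℝ] Euc k) :
    (real n i).Ext → (real n j).Ext → (real n k).Ext :=
  Quotient.map₂
    (fun x y => ⟨fun t => op (x.1 t, y.1 t),
      isNil_real_iff.2 (ElemNil.map₂ op (isNil_real_iff.1 x.2) (isNil_real_iff.1 y.2))⟩)
    (by
      rintro ⟨x, hx⟩ ⟨x', hx'⟩ h ⟨y, hy⟩ ⟨y', hy'⟩ h'
      have e1 := Ext.mk_real_eq_iff.1 (Quotient.sound h : Ext.mk x hx = Ext.mk x' hx')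
      have e2 := Ext.mk_real_eq_iff.1 (Quotient.sound h' : Ext.mk y hy = Ext.mk y' hy')
      refine Quotient.exact (s := (real n k).simSetoid) (Ext.mk_real_eq_iff.2 ?_)
      refine IsBigO.trans_isLittleO (IsBigO.of_bound ‖op‖ (Eventually.of_forall fun t => ?_))
        (e1.prod_left e2)
      rw [← map_sub]
      exact op.le_opNorm _)

/-- Addition of `•ℝ^k`, defined pointwise on representatives. -/
instance [Fact (1 ≤ n)] {k : ℕ} : Add (real n k).Ext :=
  ⟨Ext.linMap₂ (ContinuousLinearMap.fst ℝ _ _ + ContinuousLinearMap.snd ℝ _ _)⟩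

/-- The product `h · b ∈ •ℝ^k` of an extended real `h ∈ •ℝ` with a standard vector `b ∈ ℝ^k`,
defined pointwise on representatives. -/
def Ext.smulVec [Fact (1 ≤ n)] {k : ℕ} (h : (real n 1).Ext) (b : Euc k) : (real n k).Ext :=
  Ext.linMap₂ (((EuclideanSpace.proj (0 : Fin 1)).smulRight b).comp
    (ContinuousLinearMap.fst ℝ (Euc 1) (Euc 1))) h h

/-- The pair `⟨p, x⟩ ∈ •(ℝ^p × ℝ^s) = •ℝ^(p+s)`, `⟨[p], [x]⟩ = [t ↦ (p_t, x_t)]`. -/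
def Ext.pair [Fact (1 ≤ n)] {p s : ℕ} (a : (real n p).Ext) (x : (real n s).Ext) :
    (real n (p + s)).Ext :=
  Ext.linMap₂ (EuclideanSpace.finAddEquivProd (𝕜 := ℝ) (n := p) (m := s)).symm a x

/-! ### Extended spaces -/

/-- The topology of `•ℝ^s`, generated by the sets `•U` with `U` open in `ℝ^s`. -/
@[reducible] def extTop (n : ℕ∞) (s : ℕ) : TopologicalSpace (real n s).Ext :=
  generateFrom {W | ∃ U : Opens (Euc s), W = (real n s).extSet (U : Set (Euc s))}

/-- `U × V` as an open set of `ℝ^(p+s)`. -/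
def prodOpens {p s : ℕ} (U : Opens (Euc p)) (V : Opens (Euc s)) : Opens (Euc (p + s)) where
  carrier := {z | (EuclideanSpace.finAddEquivProd (𝕜 := ℝ) z).1 ∈ U ∧
    (EuclideanSpace.finAddEquivProd (𝕜 := ℝ) z).2 ∈ V}
  is_open' := by
    have hc := (EuclideanSpace.finAddEquivProd (𝕜 := ℝ) (n := p) (m := s)).continuous
    exact (U.isOpen.preimage (continuous_fst.comp hc)).inter
      (V.isOpen.preimage (continuous_snd.comp hc))

/-- The arrows `f : S → T` of the category of subsets of the spaces `•ℝ^s`: near every point of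
`S` one has `f(x) = •g⟨p, x⟩` for a parameter `p ∈ •U` and a `C^n` map `g : U × V → ℝ^t`. -/
def IsSArrow [Fact (1 ≤ n)] {s t : ℕ} (S : Set (real n s).Ext) (T : Set (real n t).Ext)
    (f : S → T) : Prop :=
  ∀ σ : S, ∃ (k : ℕ) (p : (real n k).Ext) (U : Opens (Euc k)) (V : Opens (Euc s))
    (g : Hom (ofOpen n (prodOpens U V)) (real n t)),
    p ∈ (real n k).extSet (U : Set (Euc k)) ∧ σ.1 ∈ (real n s).extSet (V : Set (Euc s)) ∧
    ∀ x : S, x.1 ∈ (real n s).extSet (V : Set (Euc s)) →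
      ∃ ζ : (ofOpen n (prodOpens U V)).Ext,
        Ext.map ((real n (k + s)).incl _) ζ = Ext.pair p x.1 ∧ (f x).1 = Ext.map g ζ

/-- The generating figures `d : T → Z` of the extended space `•(ZX)`, for `Z ⊆ •X`: constants, and
restrictions `d = •h|_T` of extensions of figures `h : V → X` with `T ⊆ •V`. -/
def IsGenFig (X : CnSpace n) (Z : Set X.Ext) {t : ℕ} (T : Set (real n t).Ext)
    (d : T → X.Ext) : Prop :=
  (∀ τ, d τ ∈ Z) ∧
  ((∃ c, ∀ τ, d τ = c) ∨
    ∃ (V : Opens (Euc t)) (h : Hom (ofOpen n V) X),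
      T ⊆ (real n t).extSet (V : Set (Euc t)) ∧
      ∀ (ζ : (ofOpen n V).Ext) (hζ : Ext.map ((real n t).incl _) ζ ∈ T), d ⟨_, hζ⟩ = Ext.map h ζ)

/-- The figures `δ : S → Z` of the extended space `•(ZX)`: locally, a generating figure composed
with an arrow `f` between subsets of the spaces `•ℝ^s`. -/
def IsExtFig [Fact (1 ≤ n)] (X : CnSpace n) (Z : Set X.Ext) {s : ℕ} (S : Set (real n s).Ext)
    (δ : S → X.Ext) : Prop :=
  (∀ x, δ x ∈ Z) ∧
  ∀ σ : S, ∃ W : Set (real n s).Ext, IsOpen[extTop n s] W ∧ σ.1 ∈ W ∧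
    ∃ (t : ℕ) (T : Set (real n t).Ext) (f : (S ∩ W : Set (real n s).Ext) → T) (d : T → X.Ext),
      IsSArrow (S ∩ W) T f ∧ X.IsGenFig Z T d ∧
      ∀ x : (S ∩ W : Set (real n s).Ext), δ ⟨x.1, x.2.1⟩ = d (f x)

/-- The arrows `f : •(ZX) → •(WY)` of extended spaces: maps sending figures to figures. -/
def IsExtArrow [Fact (1 ≤ n)] {X Y : CnSpace n} (Z : Set X.Ext) (W : Set Y.Ext)
    (f : Z → Y.Ext) : Prop :=
  (∀ z, f z ∈ W) ∧
  ∀ (s : ℕ) (S : Set (real n s).Ext) (δ : S → Z),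
    X.IsExtFig Z S (fun x => (δ x).1) → Y.IsExtFig W S (fun x => f (δ x))

/-! ### First order infinitesimals and the derivation formula -/

/-- The first order infinitesimals `D ⊆ •ℝ`: the classes of the `h` with `h_t = O(t)`. -/
def firstOrder (n : ℕ∞) : Set (real n 1).Ext :=
  {ξ | ∃ (h : ℝ → Euc 1) (hh : (real n 1).IsNil h),
    ξ = Ext.mk h hh ∧ h =O[𝓝 0] (fun t : ℝ => t)}

/-- The element `0` of `D`. -/
def firstOrder.zero (n : ℕ∞) [Fact (1 ≤ n)] : firstOrder n :=
  ⟨Ext.mk (fun _ => (0 : Euc 1)) (isNil_real_iff.2 ⟨1, by simp⟩), _, _, rfl, isBigO_zero _ _⟩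

/-- `b ∈ ℝ^k` satisfies the derivation formula: for some `a ∈ •ℝ^k`,
`•φ(f(h)) = a + h · b` for all `h ∈ D` (in particular `f(h) ∈ •U`). -/
def IsObsDeriv [Fact (1 ≤ n)] {X : CnSpace n} {U : Set X} {k : ℕ}
    (φ : X.Observable U (⊤ : Opens (Euc k))) (f : firstOrder n → X.Ext) (b : Euc k) : Prop :=
  ∃ a : (real n k).Ext, ∀ h : firstOrder n, ∃ η : (X.sub U).Ext,
    Ext.map (X.incl U) η = f h ∧
    Ext.map (((real n k).incl _).comp φ) η = a + Ext.smulVec h.1 b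

/-- `φ'(f) ∈ ℝ^k`: the `b` of the derivation formula for `f` and the observable `φ`. -/
def obsDeriv [Fact (1 ≤ n)] {X : CnSpace n} {U : Set X} {k : ℕ}
    (φ : X.Observable U (⊤ : Opens (Euc k))) (f : firstOrder n → X.Ext) : Euc k :=
  Classical.epsilon (IsObsDeriv φ f)

end CnSpace

end

/-! Every open set of `•ℝ` containing `0` contains all of `D`, because a representative that is
`O(t)` vanishes at `t = 0`. The local description of a figure near `0` is therefore valid on the
whole of `D`. Applied to the image under `f` of the identity figure of `D`, this shows that `f` is
either constant or of the form `h ↦ •F⟨p, h⟩` for a single figure `F` of `X`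
(`IsExtArrow.isParamFig`).

For an observable `φ`, the composite `φ ∘ F` is an ordinary `C^n` map on an open set of `ℝ^(j+1)`.
As `n ≥ 1`, it has a first order expansion in `h`, and the coefficient of `h` is the partial
derivative at the standard part of `⟨p, 0⟩`. So the derivation formula has a solution
(`IsParamFig.exists_isObsDeriv`).

Setting `h = 0` shows that the constant term is `•φ(f(0))`. If `f` and `g` agree at `0` and have
equal derivatives, then `•φ(f(h)) = •φ(g(h))` for every observable, which is what `∼` tests. Passing
freely between `•U` and `•X` for open `U` rests on the fact that a zone of an open subspace is also
a zone of the whole space. -/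

namespace CnSpace

variable {n : ℕ∞} {X : CnSpace n}

/-! ### Open subspaces and their extensions -/

theorem isCn_inclusion {u : ℕ} {J H : Opens (Euc u)} (h : J ≤ H) :
    IsCn n J (fun x => ((⟨x, h x.2⟩ : H) : Euc u)) :=
  ⟨id, contDiffOn_id, fun _ => rfl⟩

/-- An open subset of an open subspace is open in the ambient space. -/
theorem isOpen_image_incl {S : Set X} (hS : IsOpen[X.top] S) {W : Set (X.sub S)}
    (hW : IsOpen[(X.sub S).top] W) : IsOpen[X.top] (X.incl S '' W) := by
  refine isOpen_top_iff.2 fun {u} H d hd => ?_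
  -- The part of `H` that `d` sends into `S`; there `d` is a figure of the subspace, so openness of
  -- `W` can be tested on it.
  let H' : Opens (Euc u) :=
    ⟨Subtype.val '' (d ⁻¹' S), H.isOpen.isOpenMap_subtype_val _ (hS H d hd)⟩
  have hle : H' ≤ H := by
    rintro _ ⟨a, -, rfl⟩
    exact a.2
  have hmem : ∀ y : H', d ⟨y, hle y.2⟩ ∈ S := by
    rintro ⟨_, a, ha, rfl⟩
    exact ha
  let d' : H' → X.sub S := fun y => ⟨d ⟨y, hle y.2⟩, hmem y⟩
  have hd' : (X.sub S).IsFig H' d' :=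
    X.comp (fun y : H' => (⟨y, hle y.2⟩ : H)) d (isCn_inclusion hle) hd
  have h1 := H'.isOpen.isOpenMap_subtype_val _ (isOpen_top_iff.1 hW H' d' hd')
  convert h1.preimage continuous_subtype_val using 1
  ext a
  constructor
  · rintro ⟨w, hw, hwa⟩
    have haS : d a ∈ S := hwa ▸ w.2
    have hw' : d' ⟨a.1, a, haS, rfl⟩ = w := Subtype.ext hwa.symm
    exact ⟨⟨a.1, a, haS, rfl⟩, mem_preimage.2 (hw'.symm ▸ hw), rfl⟩
  · rintro ⟨y, hy, hya⟩
    refine ⟨d' y, hy, ?_⟩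
    change d ⟨y, _⟩ = d a
    congr 1
    exact Subtype.ext hya

/-- The identification of an iterated subspace with a subspace. -/
def subSub (S : Set X) (T : Set (X.sub S)) : Hom ((X.sub S).sub T) (X.sub (X.incl S '' T)) where
  toFun a := ⟨a.1.1, a.1, a.2, rfl⟩
  map_fig _ _ hd := hd

/-- The identification of a subspace with an iterated subspace. -/
def subSubInv (S : Set X) (T : Set (X.sub S)) :
    Hom (X.sub (X.incl S '' T)) ((X.sub S).sub T) where
  toFun a := ⟨⟨a.1, by obtain ⟨_, w, -, rfl⟩ := a; exact w.2⟩, by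
    obtain ⟨_, w, hw, rfl⟩ := a; exact hw⟩
  map_fig _ _ hd := hd

theorem Observable.val_of_mem {U : Set X} {k : ℕ} {K : Opens (Euc k)} (φ : X.Observable U K)
    {a : X} (ha : a ∈ U) : φ.val a = (φ.toFun ⟨a, ha⟩).1 :=
  dif_pos ha

/-- Turns an observable of an open subspace into one of `X` without changing its values; off the
zone both sides are the default `0`. -/
theorem Observable.val_comp_subSubInv {S : Set X} {T : Set (X.sub S)} {k : ℕ}
    {K : Opens (Euc k)} (φ : (X.sub S).Observable T K) (a : X.sub S) :
    Observable.val (X := X) (φ.comp (subSubInv S T)) (X.incl S a) = φ.val a := by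
  by_cases ha : a ∈ T
  · rw [Observable.val_of_mem _ ha]
    exact Observable.val_of_mem _ (mem_image_of_mem _ ha)
  · have ha' : X.incl S a ∉ X.incl S '' T := by
      rintro ⟨w, hw, hwa⟩
      exact ha (Subtype.ext hwa ▸ hw)
    unfold Observable.val
    rw [dif_neg ha, dif_neg ha']

theorem mem_image_incl {S : Set X} {T : Set (X.sub S)} {a : X.sub S} :
    X.incl S a ∈ X.incl S '' T ↔ a ∈ T :=
  ⟨fun ⟨_, hw, hwa⟩ => Subtype.ext hwa ▸ hw, mem_image_of_mem _⟩

theorem IsNil.eventually_mem {x : ℝ → X} (hx : X.IsNil x) {U : Set X} (hU : IsOpen[X.top] U)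
    (h0 : x 0 ∈ U) : ∀ᶠ t in 𝓝 0, x t ∈ U := by
  let _ := X.top
  exact hx.1 (hU.mem_nhds h0)

theorem isNil_of_incl {S : Set X} (hS : IsOpen[X.top] S) {y : ℝ → X.sub S}
    (hy : X.IsNil fun t => X.incl S (y t)) : (X.sub S).IsNil y := by
  refine ⟨?_, fun W hW k K φ h0 => ?_⟩
  · let _ := (X.sub S).top
    refine tendsto_nhds.2 fun W hW h0 => ?_
    filter_upwards [hy.eventually_mem (isOpen_image_incl hS hW) (mem_image_of_mem _ h0)] with t ht using mem_image_incl.1 ht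
  · obtain ⟨m, hm⟩ := hy.2 _ (isOpen_image_incl hS hW) k K (φ.comp (subSubInv S W))
      (mem_image_of_mem _ h0)
    refine ⟨m, ?_⟩
    simpa only [Observable.val_comp_subSubInv] using hm

theorem IsNil.congr {x y : ℝ → X} (hx : X.IsNil x) (hxy : x =ᶠ[𝓝 0] y) : X.IsNil y := by
  have h0 : x 0 = y 0 := hxy.self_of_nhds
  refine ⟨?_, fun U hU k K φ hy => ?_⟩
  · have := hx.1
    unfold IsC0 at this ⊢
    rw [← h0]
    exact this.congr' hxy
  · obtain ⟨m, hm⟩ := hx.2 U hU k K φ (h0 ▸ hy)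
    refine ⟨m, hm.congr' ?_ EventuallyEq.rfl⟩
    filter_upwards [hxy] with t ht
    rw [ht, h0]

theorem Ext.mk_congr {x y : ℝ → X} {hx : X.IsNil x} {hy : X.IsNil y} (hxy : x =ᶠ[𝓝 0] y) :
    Ext.mk x hx = Ext.mk y hy := by
  refine Quotient.sound fun U hU k K φ => ⟨?_, fun _ => ?_⟩
  · change x 0 ∈ U ↔ y 0 ∈ U
    rw [hxy.self_of_nhds]
  · refine (isLittleO_zero (fun t : ℝ => t) _).congr' ?_ EventuallyEq.rfl
    filter_upwards [hxy] with t ht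
    change 0 = φ.val (x t) - φ.val (y t)
    rw [ht, sub_self]

theorem Ext.exists_rep (ξ : X.Ext) : ∃ (x : ℝ → X) (hx : X.IsNil x), Ext.mk x hx = ξ := by
  obtain ⟨x, rfl⟩ := Quotient.exists_rep ξ
  exact ⟨x.1, x.2, rfl⟩

theorem Ext.mem_iff_of_mk_eq {x y : ℝ → X} {hx : X.IsNil x} {hy : X.IsNil y}
    (h : Ext.mk x hx = Ext.mk y hy) {U : Set X} (hU : IsOpen[X.top] U) : x 0 ∈ U ↔ y 0 ∈ U := by
  have h1 : X.Sim ⟨x, hx⟩ ⟨y, hy⟩ := Quotient.exact h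
  -- `∼` compares membership in `U` only in the presence of an observable on `U`; the constant one
  -- into `ℝ^0` always exists.
  exact (h1 U hU 0 ⊤ ⟨fun _ => ⟨0, trivial⟩, fun H _ _ => (ofOpen n ⊤).const H _⟩).1

/-- A nilpotent path starting in an open set lifts, near the origin, to the open subspace. -/
theorem IsNil.exists_lift {x : ℝ → X} (hx : X.IsNil x) {U : Set X} (hU : IsOpen[X.top] U)
    (h0 : x 0 ∈ U) : ∃ (y : ℝ → X.sub U) (_ : (X.sub U).IsNil y),
      (fun t => X.incl U (y t)) =ᶠ[𝓝 0] x := by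
  classical
  -- The value at times when `x` leaves `U` is irrelevant: only the germ at `0` matters.
  let y : ℝ → X.sub U := fun t => if h : x t ∈ U then ⟨x t, h⟩ else ⟨x 0, h0⟩
  have hy : (fun t => X.incl U (y t)) =ᶠ[𝓝 0] x := by
    filter_upwards [hx.eventually_mem hU h0] with t ht
    have : y t = ⟨x t, ht⟩ := dif_pos ht
    rw [this]
    rfl
  exact ⟨y, isNil_of_incl hU (hx.congr hy.symm), hy⟩

/-- Membership in `•U` depends only on the standard part, since continuity at `0` keeps the path in
`U` for small `t`. -/
theorem mk_mem_extSet_iff {x : ℝ → X} (hx : X.IsNil x) {U : Set X} (hU : IsOpen[X.top] U) :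
    Ext.mk x hx ∈ X.extSet U ↔ x 0 ∈ U := by
  constructor
  · rintro ⟨η, hη⟩
    obtain ⟨y, hy, rfl⟩ := η.exists_rep
    exact (Ext.mem_iff_of_mk_eq (hx := hy.map (X.incl U)) hη hU).1 (y 0).2
  · intro h0
    obtain ⟨y, hy, hyx⟩ := hx.exists_lift hU h0
    exact ⟨Ext.mk y hy, Ext.mk_congr hyx⟩

/-- Justifies regarding `•U` as a subset of `•X`: lifts to `•U` are unique, so `•φ` is well defined
on points of `•X` lying in `•U`. -/
theorem map_incl_injective {U : Set X} (hU : IsOpen[X.top] U) :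
    Function.Injective (Ext.map (X.incl U)) := by
  intro η η' h
  obtain ⟨y, hy, rfl⟩ := η.exists_rep
  obtain ⟨z, hz, rfl⟩ := η'.exists_rep
  have h1 : X.Sim ⟨_, hy.map (X.incl U)⟩ ⟨_, hz.map (X.incl U)⟩ := Quotient.exact h
  refine Quotient.sound fun W hW k K φ => ?_
  obtain ⟨h2, h3⟩ := h1 _ (isOpen_image_incl hU hW) k K (φ.comp (subSubInv U W))
  simp only [Observable.val_comp_subSubInv, mem_image_incl] at h2 h3
  exact ⟨h2, h3⟩

/-! ### Computing in `•ℝ^k` with representatives -/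

theorem isOpen_real_opens {k : ℕ} (U : Opens (Euc k)) :
    IsOpen[(real n k).top] (U : Set (Euc k)) :=
  isOpen_real_iff.2 U.isOpen

theorem Ext.linMap₂_mk [Fact (1 ≤ n)] {i j k : ℕ} (op : Euc i × Euc j →L[ℝ] Euc k)
    {x : ℝ → Euc i} {y : ℝ → Euc j} (hx : (real n i).IsNil x) (hy : (real n j).IsNil y) :
    Ext.linMap₂ op (Ext.mk x hx) (Ext.mk y hy) = (Ext.mk (fun t => op (x t, y t))
      (isNil_real_iff.2 (ElemNil.map₂ op (isNil_real_iff.1 hx) (isNil_real_iff.1 hy))) :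
        (real n k).Ext) :=
  rfl

theorem Ext.mk_add_mk_smulVec [Fact (1 ≤ n)] {k : ℕ} {A : ℝ → Euc k} {x : ℝ → Euc 1}
    (hA : (real n k).IsNil A) (hx : (real n 1).IsNil x) (b : Euc k) :
    ∃ h : (real n k).IsNil (fun t => (A t + x t 0 • b : Euc k)),
      (Ext.mk A hA + Ext.smulVec (Ext.mk x hx) b : (real n k).Ext) = Ext.mk _ h := by
  have h1 := Ext.linMap₂_mk (((EuclideanSpace.proj (0 : Fin 1)).smulRight b).comp
      (ContinuousLinearMap.fst ℝ (Euc 1) (Euc 1))) hx hx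
  have h2 := congrArg (Ext.linMap₂ (ContinuousLinearMap.fst ℝ _ _ +
    ContinuousLinearMap.snd ℝ _ _) (Ext.mk A hA)) h1
  rw [Ext.linMap₂_mk] at h2
  exact ⟨_, h2⟩

theorem Ext.add_smulVec_zero [Fact (1 ≤ n)] {k : ℕ} (a : (real n k).Ext) (b : Euc k) :
    a + Ext.smulVec (firstOrder.zero n).1 b = a := by
  obtain ⟨A, hA, rfl⟩ := a.exists_rep
  obtain ⟨h, he⟩ := Ext.mk_add_mk_smulVec hA
    (isNil_real_iff.2 ⟨1, by simp⟩ : (real n 1).IsNil fun _ => (0 : Euc 1)) b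
  refine he.trans (Ext.mk_congr (Eventually.of_forall fun t => ?_))
  simp

/-! ### Parametrized figures on `D` and the derivation formula -/

/-- A map on `D` that is constant, or of the form `h ↦ •F⟨p, h⟩` for a figure `F` of `X`. -/
def IsParamFig [Fact (1 ≤ n)] (f : firstOrder n → X.Ext) : Prop :=
  (∃ c, ∀ h, f h = c) ∨
    ∃ (k : ℕ) (p : (real n k).Ext) (N : Opens (Euc (k + 1))) (F : Hom (ofOpen n N) X),
      ∀ h : firstOrder n, ∃ ζ : (ofOpen n N).Ext,
        Ext.map ((real n (k + 1)).incl _) ζ = Ext.pair p h.1 ∧ f h = Ext.map F ζ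

theorem exists_path_of_map_incl_eq_pair [Fact (1 ≤ n)] {k : ℕ} {q : ℝ → Euc k}
    (hq : (real n k).IsNil q) {N : Opens (Euc (k + 1))} {ζ : (ofOpen n N).Ext}
    {h : firstOrder n}
    (hζ : Ext.map ((real n (k + 1)).incl _) ζ = Ext.pair (Ext.mk q hq) h.1) :
    ∃ (z : ℝ → ofOpen n N) (hz : (ofOpen n N).IsNil z) (x : ℝ → Euc 1) (hx : (real n 1).IsNil x),
      Ext.mk z hz = ζ ∧ h.1 = Ext.mk x hx ∧ x =O[𝓝 0] (fun t : ℝ => t) ∧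
      (fun t => ((real n (k + 1)).incl N (z t) : Euc (k + 1)) -
        (EuclideanSpace.finAddEquivProd (𝕜 := ℝ) (n := k) (m := 1)).symm (q t, x t))
        =o[𝓝 0] (fun t : ℝ => t) := by
  obtain ⟨z, hz, rfl⟩ := ζ.exists_rep
  obtain ⟨x, hx, he, hO⟩ := h.2
  refine ⟨z, hz, x, hx, rfl, he, hO, ?_⟩
  rw [he] at hζ
  exact (Ext.mk_real_eq_iff (hx := hz.map ((real n (k + 1)).incl _))
    (hy := isNil_real_iff.2 (ElemNil.map₂ _ (isNil_real_iff.1 hq) (isNil_real_iff.1 hx)))).1 hζ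

theorem apply_zero_of_isLittleO {E : Type*} [NormedAddCommGroup E] {v : ℝ → E}
    (h : v =o[𝓝 0] (fun t : ℝ => t)) : v 0 = 0 := by
  simpa using (h.def one_pos).self_of_nhds

theorem apply_zero_of_isBigO {E : Type*} [NormedAddCommGroup E] {v : ℝ → E}
    (h : v =O[𝓝 0] (fun t : ℝ => t)) : v 0 = 0 := by
  obtain ⟨C, hC⟩ := h.bound
  simpa using hC.self_of_nhds

/-- All the points `⟨p, h⟩` with `h ∈ D` share the standard part `(p₀, 0)`, so the values of `f` lie
in the same sets `•U`. -/
theorem IsParamFig.mem_extSet [Fact (1 ≤ n)] {f : firstOrder n → X.Ext} (hf : IsParamFig f)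
    {U : Set X} (hU : IsOpen[X.top] U) (h h' : firstOrder n) (hfh : f h ∈ X.extSet U) :
    f h' ∈ X.extSet U := by
  obtain ⟨c, hc⟩ | ⟨k, p, N, F, hF⟩ := hf
  · rwa [hc h', ← hc h]
  · obtain ⟨q, hq, rfl⟩ := p.exists_rep
    obtain ⟨ζ, hζ, he⟩ := hF h
    obtain ⟨ζ', hζ', he'⟩ := hF h'
    obtain ⟨z, hz, x, hx, rfl, -, hxO, hzo⟩ := exists_path_of_map_incl_eq_pair hq hζ
    obtain ⟨z', hz', x', hx', rfl, -, hxO', hzo'⟩ := exists_path_of_map_incl_eq_pair hq hζ'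
    have h0 : z 0 = z' 0 := by
      refine Subtype.ext ?_
      have h1 := apply_zero_of_isLittleO hzo
      have h2 := apply_zero_of_isLittleO hzo'
      rw [apply_zero_of_isBigO hxO] at h1
      rw [apply_zero_of_isBigO hxO'] at h2
      exact (sub_eq_zero.1 h1).trans (sub_eq_zero.1 h2).symm
    rw [he] at hfh
    rw [he']
    refine (mk_mem_extSet_iff (hz'.map F) hU).2 ?_
    rw [← h0]
    exact (mk_mem_extSet_iff (hz.map F) hU).1 hfh

/-- Strict differentiability is needed because the base point `w₀ t` moves with `t`: nilpotency does
not make `w₀ t - a` of order `O(t)`; only the difference `w t - w₀ t` is. -/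
theorem isLittleO_of_hasStrictFDerivAt {E F : Type*} [NormedAddCommGroup E] [NormedSpace ℝ E]
    [NormedAddCommGroup F] [NormedSpace ℝ F] {Ψ : E → F} {L : E →L[ℝ] F} {a : E}
    (hΨ : HasStrictFDerivAt Ψ L a) {w w₀ v : ℝ → E} (hw : Tendsto w (𝓝 0) (𝓝 a))
    (hw₀ : Tendsto w₀ (𝓝 0) (𝓝 a)) (hv : v =O[𝓝 0] (fun t : ℝ => t))
    (h : (fun t => w t - w₀ t - v t) =o[𝓝 0] (fun t : ℝ => t)) :
    (fun t => Ψ (w t) - (Ψ (w₀ t) + L (v t))) =o[𝓝 0] (fun t : ℝ => t) := by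
  have h1 : (fun t => w t - w₀ t) =O[𝓝 0] (fun t : ℝ => t) := by
    simpa using h.isBigO.add hv
  have h2 := (hΨ.isLittleO.comp_tendsto (hw.prodMk_nhds hw₀)).trans_isBigO h1
  have h3 := ((L.isBigO_comp (fun t => w t - w₀ t - v t) (𝓝 0)).trans_isLittleO h).add h2
  refine h3.congr_left fun t => ?_
  simp only [Function.comp, map_sub]
  abel

theorem IsParamFig.exists_isObsDeriv [Fact (1 ≤ n)] {f : firstOrder n → X.Ext}
    (hf : IsParamFig f) {U : Set X} (hU : IsOpen[X.top] U) {k : ℕ}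
    (φ : X.Observable U (⊤ : Opens (Euc k))) (h0 : f (firstOrder.zero n) ∈ X.extSet U) :
    ∃ b, IsObsDeriv φ f b := by
  have hmem := fun h => hf.mem_extSet hU _ h h0
  obtain ⟨c, hc⟩ | ⟨j, p, N, F, hF⟩ := hf
  · obtain ⟨η, hη⟩ := h0
    refine ⟨0, Ext.map (((real n k).incl _).comp φ) η, fun h => ⟨η, ?_, ?_⟩⟩
    · rw [hη, hc, hc]
    · obtain ⟨y, hy, rfl⟩ := η.exists_rep
      obtain ⟨x, hx, he⟩ := h.1.exists_rep
      obtain ⟨h', he'⟩ := Ext.mk_add_mk_smulVec (hy.map (((real n k).incl _).comp φ)) hx 0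
      rw [← he]
      refine Eq.trans (Ext.mk_congr (Eventually.of_forall fun t => ?_)) he'.symm
      simp
  obtain ⟨q, hq, rfl⟩ := p.exists_rep
  have hFU : IsOpen[(ofOpen n N).top] (F ⁻¹' U) := F.isOpen_preimage hU
  have hN : IsOpen[(real n (j + 1)).top] (N : Set (Euc (j + 1))) := isOpen_real_iff.2 N.isOpen
  have lift : ∀ h : firstOrder n, ∃ (y : ℝ → (ofOpen n N).sub (F ⁻¹' U))
      (hy : ((ofOpen n N).sub (F ⁻¹' U)).IsNil y) (x : ℝ → Euc 1) (hx : (real n 1).IsNil x),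
      f h = Ext.mk _ ((hy.map ((ofOpen n N).incl _)).map F) ∧
      h.1 = Ext.mk x hx ∧ x =O[𝓝 0] (fun t : ℝ => t) ∧
      (fun t => ((real n (j + 1)).incl N ((ofOpen n N).incl _ (y t)) : Euc (j + 1)) -
        (EuclideanSpace.finAddEquivProd (𝕜 := ℝ) (n := j) (m := 1)).symm (q t, x t))
        =o[𝓝 0] (fun t : ℝ => t) := by
    intro h
    obtain ⟨ζ, hζ, he⟩ := hF h
    obtain ⟨z, hz, x, hx, rfl, hxe, hxO, hzo⟩ := exists_path_of_map_incl_eq_pair hq hζ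
    have hz0 : z 0 ∈ F ⁻¹' U := by
      have h1 := hmem h
      rw [he] at h1
      exact (mk_mem_extSet_iff (hz.map F) hU).1 h1
    obtain ⟨y, hy, hyz⟩ := hz.exists_lift hFU hz0
    refine ⟨y, hy, x, hx, he.trans ?_, hxe, hxO, ?_⟩
    · exact congrArg (Ext.map F) (Ext.mk_congr (hx := hz) (hy := hy.map ((ofOpen n N).incl _)) hyz.symm)
    · refine hzo.congr' ?_ EventuallyEq.rfl
      filter_upwards [hyz] with t ht
      rw [ht]
  obtain ⟨y₀, hy₀, x₀, hx₀, -, hx₀e, -, hyo₀⟩ := lift (firstOrder.zero n)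
  -- The representative obtained for `0 ∈ D` need not be the zero path, only `o(t)`.
  have hxo₀ : x₀ =o[𝓝 0] (fun t : ℝ => t) := by
    have h1 := (Ext.mk_real_eq_iff (hx := isNil_real_iff.2 ⟨1, by simp⟩)).1 hx₀e
    simpa using h1.neg_left
  -- `φ ∘ F` as an observable of `ℝ^(j+1)`, hence an ordinary `C^n` map.
  let Ψ : (real n (j + 1)).Observable ((real n (j + 1)).incl N '' (F ⁻¹' U))
      (⊤ : Opens (Euc k)) := (φ.comp (F.restrictPreimage U)).comp (subSubInv _ (F ⁻¹' U))
  have hΨU : IsOpen[(real n (j + 1)).top] ((real n (j + 1)).incl N '' (F ⁻¹' U)) :=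
    isOpen_image_incl hN hFU
  have hval : ∀ u : (ofOpen n N).sub (F ⁻¹' U),
      (((real n k).incl _).comp φ) (F.restrictPreimage U u) =
        Ψ.val ((real n (j + 1)).incl N ((ofOpen n N).incl _ u)) := fun u =>
    ((Observable.val_comp_subSubInv (φ.comp (F.restrictPreimage U)) _).trans
      (Observable.val_of_mem (φ.comp (F.restrictPreimage U)) u.2)).symm
  have hn : ((n : ℕ∞) : WithTop ℕ∞) ≠ 0 := by
    have h1 : n ≠ 0 := Order.one_le_iff_ne_zero.1 Fact.out
    exact_mod_cast h1
  have hΨ := ((Ψ.contDiffOn_val hΨU).contDiffAt ((isOpen_real_iff.1 hΨU).mem_nhds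
    (mem_image_of_mem ((real n (j + 1)).incl N) (y₀ 0).2))).hasStrictFDerivAt hn
  let E := (EuclideanSpace.finAddEquivProd (𝕜 := ℝ) (n := j) (m := 1)).symm
  let η₀ := Ext.mk _ (hy₀.map (F.restrictPreimage U))
  let w : ((ofOpen n N).sub (F ⁻¹' U)) → Euc (j + 1) := fun u =>
    (real n (j + 1)).incl N ((ofOpen n N).incl _ u)
  let L : Euc (j + 1) →L[ℝ] Euc k := fderiv ℝ Ψ.val (w (y₀ 0))
  have hΨ' : HasStrictFDerivAt (Ψ.val : Euc (j + 1) → Euc k) L (w (y₀ 0)) := hΨ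
  have hw : ∀ {y : ℝ → (ofOpen n N).sub (F ⁻¹' U)}, ((ofOpen n N).sub (F ⁻¹' U)).IsNil y →
      Tendsto (fun t => w (y t)) (𝓝 0) (𝓝 (w (y 0))) := fun hy =>
    (isNil_real_iff.1 ((hy.map ((ofOpen n N).incl _)).map ((real n (j + 1)).incl N))).tendsto
  -- The derivative of `φ ∘ F` in the direction of its last variable, at the common standard part;
  -- the constant term is `•φ(f(0))`.
  refine ⟨L (E (0, EuclideanSpace.single 0 1)), Ext.map (((real n k).incl _).comp φ) η₀, fun h => ?_⟩
  obtain ⟨y, hy, x, hx, hfh, hxe, hxO, hyo⟩ := lift h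
  refine ⟨Ext.mk _ (hy.map (F.restrictPreimage U)), hfh.symm, ?_⟩
  obtain ⟨hs, he⟩ := Ext.mk_add_mk_smulVec
    ((hy₀.map (F.restrictPreimage U)).map (((real n k).incl _).comp φ)) hx
    (L (E (0, EuclideanSpace.single 0 1)))
  rw [hxe]
  refine Eq.trans ?_ he.symm
  refine (Ext.mk_real_eq_iff
    (hx := (hy.map (F.restrictPreimage U)).map (((real n k).incl _).comp φ)) (hy := hs)).2 ?_
  have hE : ∀ v : ℝ → Euc 1, (fun t => E (0, v t)) =O[𝓝 0] v := fun v => by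
    have h1 := (E : (Euc j × Euc 1) →L[ℝ] Euc (j + 1)).isBigO_comp (fun t => ((0 : Euc j), v t))
      (𝓝 0)
    exact h1.trans ((isBigO_zero _ _).prod_left (isBigO_refl _ _))
  -- The parameter `q` is common to both paths and cancels, leaving the increment `(0, x t)` up to
  -- `o(t)`.
  have key : (fun t => w (y t) - w (y₀ t) - E (0, x t)) =o[𝓝 0] (fun t : ℝ => t) := by
    refine ((hyo.sub hyo₀).sub ((hE x₀).trans_isLittleO hxo₀)).congr_left fun t => ?_
    have h1 : E (q t, x t) = E (q t, 0) + E (0, x t) := by rw [← map_add]; simp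
    have h2 : E (q t, x₀ t) = E (q t, 0) + E (0, x₀ t) := by rw [← map_add]; simp
    change (w (y t) - E (q t, x t)) - (w (y₀ t) - E (q t, x₀ t)) - E (0, x₀ t) = _
    rw [h1, h2]
    abel
  have hw0 : w (y 0) = w (y₀ 0) := by
    have h1 := apply_zero_of_isLittleO key
    have h2 : E (0, 0) = 0 := map_zero E
    simpa [apply_zero_of_isBigO hxO, h2, sub_eq_zero] using h1
  refine (isLittleO_of_hasStrictFDerivAt hΨ' (hw0 ▸ hw hy) (hw hy₀) ((hE x).trans hxO)
    key).congr_left fun t => ?_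
  have hx1 : E (0, x t) = x t 0 • E (0, EuclideanSpace.single 0 1) := by
    rw [← map_smul]
    congr 1
    refine Prod.ext (by simp) ?_
    ext i
    simp [Fin.fin_one_eq_zero i]
  rw [hx1, map_smul]
  exact congrArg₂ (fun a b : Euc k => a - (b + x t 0 • L (E (0, EuclideanSpace.single 0 1))))
    (hval (y t)).symm (hval (y₀ t)).symm

/-! ### Arrows out of `D` are parametrized figures -/

theorem mem_extSet_univ [Fact (1 ≤ n)] {k : ℕ} (ξ : (real n k).Ext) :
    ξ ∈ (real n k).extSet ((⊤ : Opens (Euc k)) : Set (Euc k)) := by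
  obtain ⟨x, hx, rfl⟩ := ξ.exists_rep
  exact (mk_mem_extSet_iff hx (isOpen_real_opens ⊤)).2 trivial

/-- The projection `U × V → ℝ^s`. -/
noncomputable def sndHom (n : ℕ∞) {p s : ℕ} (U : Opens (Euc p)) (V : Opens (Euc s)) :
    Hom (ofOpen n (prodOpens U V)) (real n s) where
  toFun a := (EuclideanSpace.finAddEquivProd (𝕜 := ℝ) a.1).2
  map_fig H d hd := by
    obtain ⟨G, hG, hGd⟩ := hd
    refine ⟨fun x => (EuclideanSpace.finAddEquivProd (𝕜 := ℝ) (G x)).2, ?_, fun x => ?_⟩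
    · exact (((ContinuousLinearMap.snd ℝ _ _).comp (EuclideanSpace.finAddEquivProd (𝕜 := ℝ)
        (n := p) (m := s) : Euc (p + s) →L[ℝ] (Euc p × Euc s))).contDiff).comp_contDiffOn hG
    · simp only [hGd]
      rfl

theorem isSArrow_inclusion [Fact (1 ≤ n)] {s : ℕ} {S T : Set (real n s).Ext} (h : S ⊆ T) :
    IsSArrow S T (inclusion h) := by
  intro σ
  -- No parameter is needed, so it is taken in `ℝ^0`, with the second projection as `g`.
  have hp : (real n 0).IsNil (fun _ => (0 : Euc 0)) := isNil_real_iff.2 ⟨1, by simp⟩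
  let p : (real n 0).Ext := Ext.mk _ hp
  refine ⟨0, p, ⊤, ⊤, sndHom n ⊤ ⊤, mem_extSet_univ _, mem_extSet_univ _, fun x _ => ?_⟩
  obtain ⟨y, hy, hxy⟩ := x.1.exists_rep
  have hpair : Ext.pair p x.1 ∈
      (real n (0 + s)).extSet (prodOpens (⊤ : Opens (Euc 0)) (⊤ : Opens (Euc s))) := by
    rw [← hxy]
    exact (mk_mem_extSet_iff _ (isOpen_real_opens _)).2 ⟨trivial, trivial⟩
  obtain ⟨ζ, hζ⟩ := hpair
  refine ⟨ζ, hζ, ?_⟩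
  obtain ⟨z, hz, rfl⟩ := ζ.exists_rep
  change x.1 = _
  rw [← hxy] at hζ ⊢
  have h1 := (Ext.mk_real_eq_iff (hx := hz.map ((real n (0 + s)).incl _))
    (hy := isNil_real_iff.2 (ElemNil.map₂ _ (isNil_real_iff.1 hp) (isNil_real_iff.1 hy)))).1 hζ
  refine (Ext.mk_real_eq_iff (hy := hz.map (sndHom n ⊤ ⊤))).2 ?_
  have h2 := (((ContinuousLinearMap.snd ℝ _ _).comp (EuclideanSpace.finAddEquivProd (𝕜 := ℝ)
    (n := 0) (m := s) : Euc (0 + s) →L[ℝ] (Euc 0 × Euc s))).isBigO_comp _ (𝓝 0)).trans_isLittleO h1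
  refine h2.neg_left.congr_left fun t => ?_
  rw [map_sub, neg_sub]
  exact congrArg (fun b : Euc 0 × Euc s =>
    b.2 - (EuclideanSpace.finAddEquivProd (𝕜 := ℝ) (n := 0) (m := s)
      ((real n (0 + s)).incl _ (z t))).2)
    ((EuclideanSpace.finAddEquivProd (𝕜 := ℝ) (n := 0) (m := s)).apply_symm_apply (0, y t))

theorem isExtFig_id [Fact (1 ≤ n)] {s : ℕ} (S : Set (real n s).Ext) :
    (real n s).IsExtFig S S (fun x => x.1) := by
  refine ⟨fun x => x.2, fun σ => ⟨univ, @isOpen_univ _ (extTop n s), trivial, s, S,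
    inclusion inter_subset_left, fun x => x.1, isSArrow_inclusion _, ⟨fun x => x.2, Or.inr
    ⟨⊤, (real n s).incl _, fun ξ _ => mem_extSet_univ ξ, fun ζ hζ => rfl⟩⟩, fun x => rfl⟩⟩

/-- `D` cannot be cut by open sets: all its points have standard part `0`. This makes local data at
`0` global on `D`. -/
theorem firstOrder_subset_of_isOpen [Fact (1 ≤ n)] {W : Set (real n 1).Ext}
    (hW : IsOpen[extTop n 1] W) (h0 : (firstOrder.zero n).1 ∈ W) : firstOrder n ⊆ W := by
  induction hW with
  | basic s hs =>
    obtain ⟨U, rfl⟩ := hs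
    rintro _ ⟨x, hx, rfl, hO⟩
    refine (mk_mem_extSet_iff hx (isOpen_real_opens U)).2 ?_
    rw [apply_zero_of_isBigO hO]
    exact (mk_mem_extSet_iff _ (isOpen_real_opens U)).1 h0
  | univ => exact subset_univ _
  | inter s t _ _ hs ht => exact subset_inter (hs h0.1) (ht h0.2)
  | sUnion S _ hS =>
    obtain ⟨s, hs, h0⟩ := h0
    exact (hS s hs h0).trans (subset_sUnion_of_mem hs)

/-- An arrow `D → •X` is constant or of the form `h ↦ •F⟨p, h⟩`. -/
theorem IsExtArrow.isParamFig [Fact (1 ≤ n)] {f : firstOrder n → X.Ext}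
    (hf : IsExtArrow (firstOrder n) (univ : Set X.Ext) f) : IsParamFig f := by
  -- The identity of `D` is a figure, so `f` itself is one; its local form is read at `0`.
  obtain ⟨W, hW, h0W, t, T, a, d, ha, ⟨-, hd⟩, hfd⟩ :=
    (hf.2 1 (firstOrder n) id (isExtFig_id _)).2 (firstOrder.zero n)
  have hDW := firstOrder_subset_of_isOpen hW h0W
  let x (h : firstOrder n) : (firstOrder n ∩ W : Set _) := ⟨h.1, h.2, hDW h.2⟩
  have hfx : ∀ h, f h = d (a (x h)) := fun h => hfd (x h)
  obtain ⟨c, hc⟩ | ⟨V', e, hTV', he⟩ := hd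
  · exact Or.inl ⟨c, fun h => (hfx h).trans (hc _)⟩
  obtain ⟨k, p, U, V, g, hp, h0V, hg⟩ := ha (x (firstOrder.zero n))
  have hDV : firstOrder n ⊆ (real n 1).extSet (V : Set (Euc 1)) :=
    firstOrder_subset_of_isOpen (isOpen_generateFrom_of_mem ⟨V, rfl⟩) h0V
  have hN : IsOpen[(real n (k + 1)).top] (prodOpens U V : Set (Euc (k + 1))) :=
    isOpen_real_opens _
  have hV' : IsOpen[(real n t).top] (V' : Set (Euc t)) := isOpen_real_opens _
  have hM : IsOpen[(ofOpen n (prodOpens U V)).top] (g ⁻¹' V') := g.isOpen_preimage hV'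
  have hO : IsOpen[(real n (k + 1)).top] ((real n (k + 1)).incl (prodOpens U V) '' (g ⁻¹' V')) :=
    isOpen_image_incl hN hM
  -- The composite of `e` with `g` makes sense only where `g` takes values in `V'`; this open part
  -- of `U × V` is the domain of the figure `F`.
  let r : Hom (ofOpen n ⟨_, isOpen_real_iff.1 hO⟩)
      ((ofOpen n (prodOpens U V)).sub (g ⁻¹' (V' : Set (Euc t)))) :=
    subSubInv (X := real n (k + 1)) (prodOpens U V : Set (Euc (k + 1))) _
  refine Or.inr ⟨k, p, _,
    (Hom.comp (Y := ofOpen n V') e (g.restrictPreimage (V' : Set (Euc t)))).comp r, fun h => ?_⟩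
  obtain ⟨ζ, hζ, haζ⟩ := hg (x h) (hDV h.2)
  obtain ⟨ξ, hξ⟩ := hTV' (a (x h)).2
  obtain ⟨z, hz, rfl⟩ := ζ.exists_rep
  -- `•g ζ` lies in `T ⊆ •V'`, so the standard part of `ζ` lies in the smaller domain.
  have hz0 : z 0 ∈ g ⁻¹' V' := (mk_mem_extSet_iff (hz.map g) hV').1 ⟨ξ, hξ.trans haζ⟩
  obtain ⟨y, hy, hyz⟩ := hz.exists_lift hM hz0
  have hyz' : Ext.map ((ofOpen n (prodOpens U V)).incl (g ⁻¹' V')) (Ext.mk y hy) = Ext.mk z hz :=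
    Ext.mk_congr hyz
  have hξy : ξ = Ext.map (g.restrictPreimage V') (Ext.mk y hy) := by
    refine map_incl_injective hV' (hξ.trans (haζ.trans ?_))
    rw [← hyz']
    rfl
  refine ⟨Ext.map (subSub (X := real n (k + 1)) (prodOpens U V : Set (Euc (k + 1)))
    (g ⁻¹' (V' : Set (Euc t)))) (Ext.mk y hy), ?_, ?_⟩
  · refine Eq.trans ?_ hζ
    rw [← hyz']
    rfl
  · have hmem : Ext.map ((real n t).incl V') ξ ∈ T := hξ ▸ (a (x h)).2
    have h1 : a (x h) = ⟨_, hmem⟩ := Subtype.ext hξ.symm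
    refine (hfx h).trans ((congrArg d h1).trans ((he ξ hmem).trans ?_))
    rw [hξy]
    rfl

end CnSpace

/-! ### Separation of arrows by derivatives of observables -/

open CnSpace in
theorem mainTheorem10 (n : ℕ∞) [Fact (1 ≤ n)] (X : CnSpace n)
    (f g : CnSpace.firstOrder n → X.Ext)
    (hf : CnSpace.IsExtArrow (CnSpace.firstOrder n) (Set.univ : Set X.Ext) f)
    (hg : CnSpace.IsExtArrow (CnSpace.firstOrder n) (Set.univ : Set X.Ext) g)
    (h0 : f (CnSpace.firstOrder.zero n) = g (CnSpace.firstOrder.zero n))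
    (hφ : ∀ (U : Set X), IsOpen[X.top] U → ∀ (k : ℕ)
      (φ : X.Observable U (⊤ : Opens (Euc k))),
      f (CnSpace.firstOrder.zero n) ∈ X.extSet U →
        CnSpace.obsDeriv φ f = CnSpace.obsDeriv φ g) :
    f = g := by
  have hf' := hf.isParamFig
  have hg' := hg.isParamFig
  funext h
  obtain ⟨y, hy, hyf⟩ := (f h).exists_rep
  obtain ⟨z, hz, hzg⟩ := (g h).exists_rep
  rw [← hyf, ← hzg]
  refine Quotient.sound fun U hU k K φ => ?_
  have hfU : y 0 ∈ U ↔ f (firstOrder.zero n) ∈ X.extSet U := by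
    rw [← mk_mem_extSet_iff hy hU, hyf]
    exact ⟨hf'.mem_extSet hU _ _, hf'.mem_extSet hU _ _⟩
  have hgU : z 0 ∈ U ↔ g (firstOrder.zero n) ∈ X.extSet U := by
    rw [← mk_mem_extSet_iff hz hU, hzg]
    exact ⟨hg'.mem_extSet hU _ _, hg'.mem_extSet hU _ _⟩
  refine ⟨hfU.trans (h0 ▸ hgU.symm), fun hyU => ?_⟩
  have hf0 := hfU.1 hyU
  have hzU : z 0 ∈ U := hgU.2 (h0 ▸ hf0)
  -- Derivatives are taken for observables into all of `ℝ^k`; enlarging the codomain from `K` leaves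
  -- the values unchanged.
  let ψ : X.Observable U (⊤ : Opens (Euc k)) :=
    { toFun := fun a => ⟨(φ.toFun a).1, trivial⟩
      map_fig := φ.map_fig }
  have hψ : ∀ a, ψ.val a = φ.val a := fun a => rfl
  -- `obsDeriv` is a choice, so existence alone gives the formula for the chosen vector.
  obtain ⟨a, ha⟩ : IsObsDeriv ψ f (obsDeriv ψ f) :=
    Classical.epsilon_spec (hf'.exists_isObsDeriv hU ψ hf0)
  obtain ⟨a', ha'⟩ : IsObsDeriv ψ g (obsDeriv ψ g) :=
    Classical.epsilon_spec (hg'.exists_isObsDeriv hU ψ (h0 ▸ hf0))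
  -- At `h = 0` both constant terms are the value of `•ψ` at the common point `f(0) = g(0)`, whose
  -- lift to `•U` is unique.
  have haa : a = a' := by
    obtain ⟨η, hη, hηa⟩ := ha (firstOrder.zero n)
    obtain ⟨η', hη', hηa'⟩ := ha' (firstOrder.zero n)
    have h1 : η = η' := map_incl_injective hU (hη.trans (h0.trans hη'.symm))
    rw [Ext.add_smulVec_zero] at hηa hηa'
    rw [← hηa, ← hηa', h1]
  obtain ⟨η, hη, hηa⟩ := ha h
  obtain ⟨η', hη', hηa'⟩ := ha' h
  rw [← hφ U hU k ψ hf0, ← haa, ← hηa] at hηa'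
  obtain ⟨u, hu, huy⟩ := hy.exists_lift hU hyU
  obtain ⟨v, hv, hvz⟩ := hz.exists_lift hU hzU
  have hηu : η = Ext.mk u hu := map_incl_injective hU
    (hη.trans (hyf.symm.trans (Ext.mk_congr (hy := hu.map (X.incl U)) huy.symm)))
  have hηv : η' = Ext.mk v hv := map_incl_injective hU
    (hη'.trans (hzg.symm.trans (Ext.mk_congr (hy := hv.map (X.incl U)) hvz.symm)))
  rw [hηu, hηv] at hηa'
  have h1 := (Ext.mk_real_eq_iff (hx := hv.map (((real n k).incl _).comp ψ))
    (hy := hu.map (((real n k).incl _).comp ψ))).1 hηa'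
  refine h1.symm.congr' ?_ EventuallyEq.rfl
  filter_upwards [huy, hvz] with t ht ht'
  rw [← ht, ← ht']
  exact congrArg₂ (fun a b : Euc k => a - b) (φ.val_of_mem (u t).2).symm
    (φ.val_of_mem (v t).2).symm
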